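/- A subdirect power of an algebra $(A,f)$ with one unary operation $f:A\to A$ is a subset of some cartesian power $A^X$ ($X$ an arbitrary set) that is closed under the coordinatewise action of $f$ and projects onto $A$ in every coordinate. Two subdirect powers (possibly with different $X$) are isomorphic if there is a bijection between them commuting with the coordinatewise actions of $f$. Let $\mathcal{A}=(A,f)$ with $A=\{0,1,2\}$ and $f(x)=\max(x-1,0)$, and let $\kappa$ be any infinite cardinal. Then the number of subdirect powers of $\mathcal{A}$ of cardinality $\kappa$, counted up to isomorphism, is exactly $2^\alpha$, where $\alpha$ is the number of cardinals $\beta\leq\kappa$ (finite and infinite). In particular, if the continuum hypothesis $2^{\aleph_0}=\aleph_1$ holds, then the number of subdirect powers of $\mathcal{A}$ of cardinality $\aleph_1$, up to isomorphism, is $2^{\aleph_0}$, and $2^{\aleph_0}<2^{\aleph_1}$. -/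

import Mathlib

open scoped Cardinal

universe u

/-- A subdirect power of the mono-unary algebra `(A, f)`: a subalgebra of a cartesian power
`A ^ Index` (with the operation `f` acting coordinatewise) which projects onto `A` in every
coordinate. -/
structure SubdirectPower {A : Type} (f : A → A) where
  /-- the set of coordinates, of arbitrary size -/
  Index : Type u
  /-- the elements of the subalgebra -/
  carrier : Set (Index → A)
  closed : ∀ x ∈ carrier, (fun i => f (x i)) ∈ carrier
  subdirect : ∀ (i : Index) (a : A), ∃ x ∈ carrier, x i = a

namespace SubdirectPower

variable {A : Type} {f : A → A}

/-- The operation of a subdirect power, viewed as a mono-unary algebra on its carrier. -/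
def op (S : SubdirectPower.{u} f) (x : S.carrier) : S.carrier :=
  ⟨fun i => f (x.1 i), S.closed x.1 x.2⟩

/-- Isomorphism as abstract mono-unary algebras: a bijection of the carriers that commutes with
the operations (the index sets and the embeddings into the powers play no role). -/
def Iso (S T : SubdirectPower.{u} f) : Prop :=
  ∃ e : S.carrier ≃ T.carrier, ∀ x : S.carrier, e (S.op x) = T.op (e x)

theorem Iso.refl (S : SubdirectPower.{u} f) : S.Iso S :=
  ⟨Equiv.refl _, fun _ => rfl⟩

theorem Iso.symm {S T : SubdirectPower.{u} f} : S.Iso T → T.Iso S := by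
  rintro ⟨e, he⟩
  refine ⟨e.symm, fun y => ?_⟩
  rw [Equiv.symm_apply_eq, he, Equiv.apply_symm_apply]

theorem Iso.trans {S T U : SubdirectPower.{u} f} : S.Iso T → T.Iso U → S.Iso U := by
  rintro ⟨e, he⟩ ⟨g, hg⟩
  refine ⟨e.trans g, fun x => ?_⟩
  simp only [Equiv.trans_apply, he, hg]

/-- The isomorphism relation on the subdirect powers of `(A, f)` of cardinality `κ`. -/
def isoSetoid (f : A → A) (κ : Cardinal.{u}) :
    Setoid {S : SubdirectPower.{u} f // #S.carrier = κ} where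
  r S T := S.1.Iso T.1
  iseqv := ⟨fun S => Iso.refl S.1, Iso.symm, Iso.trans⟩

end SubdirectPower

/-- The number of subdirect powers of `(A, f)` of cardinality `κ`, counted up to isomorphism. -/
noncomputable def numSubdirectPowers {A : Type} (f : A → A) (κ : Cardinal.{u}) :
    Cardinal.{u + 1} :=
  #(Quotient (SubdirectPower.isoSetoid f κ))

/-- The operation `x ↦ max (x - 1, 0)` on `{0, 1, 2}` (natural subtraction is truncated). -/
def predOp (x : Fin 3) : Fin 3 :=
  ⟨(x : ℕ) - 1, by omega⟩

theorem predOp_eq_max (x : Fin 3) : ((predOp x : ℕ) : ℤ) = max (((x : ℕ) : ℤ) - 1) 0 := by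
  simp only [predOp]
  omega

/-!
The square of `predOp` is constantly `0`, so in a subdirect power the second iterate of the
operation is constant as well: a subdirect power is a rooted tree of height at most two, the
operation sending every element to its parent and fixing the root.

Upper bound. Such a tree is determined up to isomorphism by the number of vertices of depth one
that have exactly `β` children, for every cardinal `β` (`exists_equiv_of_profile_eq`). For a tree of
cardinality `κ` this datum is a function between sets of cardinality `α = #{β // β ≤ κ}`, and there
are `α ^ α = 2 ^ α` of them.

Lower bound. A tree whose points are separated by homomorphisms into `({0, 1, 2}, predOp)` mapping
one fixed vertex `t` to `2` embeds in the power indexed by these homomorphisms, and the images of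
`t`, of its parent and of the root show that every projection is onto
(`exists_subdirectPower_of_separating`). This applies to every tree with a branch
`root — stem — tip` in which `stem` has no other child. For a set `T` of cardinals below `κ`, none
of them `0` or `1`, consider such a tree with `κ` childless vertices of depth one and, for each
`β ∈ T`, one vertex with exactly `β` children. It has cardinality `κ`, and the set of cardinalities
of the fibres of its operation is `{0, 1, κ} ∪ T`, from which `T` can be recovered. There are
`2 ^ α` sets `T`.
-/

open Cardinal Set Function

namespace UnaryTree

/-! ### Classification of trees of height two -/

section Classification

variable {M N : Type u}

/-- If the second iterate of `s` is constantly `a`, then `a` is fixed by `s`. -/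
theorem apply_root {s : M → M} {a : M} (hs : ∀ x, s (s x) = a) : s a = a := by
  simpa only [hs a] using hs (s a)

/-- The number of vertices outside `s ⁻¹' {a}` that are mapped to `x`. For a tree with root `a` and
parent map `s` these are the children of `x` of depth two, so the value at `a` is `0`. -/
noncomputable def childCount (s : M → M) (a x : M) : Cardinal.{u} :=
  #{w // s w ≠ a ∧ s w = x}

/-- The root (`p` true) or a vertex of depth one (`p` false), together with its number of children
of depth two: the profile counts how often each such label occurs. -/
noncomputable def profile (s : M → M) (a : M) (p : Prop) (β : Cardinal.{u}) : Cardinal.{u} :=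
  #{x : {x // s x = a} // ((x.1 = a) = p) ∧ childCount s a x.1 = β}

/-- Two trees of height at most two with equal profiles are isomorphic: first the vertices of depth
at most one are matched, respecting the numbers of children, and then their children. -/
theorem exists_equiv_of_profile_eq {s : M → M} {t : N → N} {a : M} {b : N}
    (hs : ∀ x, s (s x) = a) (ht : ∀ x, t (t x) = b)
    (h : ∀ p β, profile s a p β = profile t b p β) :
    ∃ e : M ≃ N, ∀ x, e (s x) = t (e x) := by
  classical
  let g : {x // s x = a} → Prop × Cardinal.{u} := fun x => (x.1 = a, childCount s a x.1)
  let g' : {x // t x = b} → Prop × Cardinal.{u} := fun x => (x.1 = b, childCount t b x.1)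
  have hg : ∀ c, Nonempty ({x // g x = c} ≃ {y // g' y = c}) := by
    rintro ⟨p, β⟩
    rw [← Cardinal.eq]
    simpa only [profile, g, g', Prod.mk.injEq] using h p β
  let e₁ : {x // s x = a} ≃ {y // t y = b} := Equiv.ofFiberEquiv fun c => (hg c).some
  have he₁ : ∀ x, g' (e₁ x) = g x := Equiv.ofFiberEquiv_map _
  have hroot : e₁ ⟨a, apply_root hs⟩ = ⟨b, apply_root ht⟩ := by
    have : ((e₁ ⟨a, apply_root hs⟩).1 = b) = (a = a) :=
      congrArg Prod.fst (he₁ ⟨a, apply_root hs⟩)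
    exact Subtype.ext (this.mpr rfl)
  -- The vertices of depth two are matched over their parents, via `e₁`.
  let φ : {x // ¬ s x = a} → {y // t y = b} := fun x => e₁ ⟨s x.1, hs x.1⟩
  let ψ : {y // ¬ t y = b} → {y // t y = b} := fun y => ⟨t y.1, ht y.1⟩
  have hφ : ∀ c, Nonempty ({x // φ x = c} ≃ {y // ψ y = c}) := by
    intro c
    obtain ⟨d, rfl⟩ := e₁.surjective c
    have hcount : childCount t b (e₁ d).1 = childCount s a d.1 := congrArg Prod.snd (he₁ d)
    obtain ⟨k⟩ := Cardinal.eq.1 hcount.symm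
    refine ⟨Equiv.trans ?_ (k.trans ?_)⟩
    · refine (Equiv.subtypeEquivRight fun x => ?_).trans
        (Equiv.subtypeSubtypeEquivSubtypeInter (fun x => ¬ s x = a) fun x => s x = d.1)
      simp only [φ, e₁.apply_eq_iff_eq, Subtype.ext_iff]
    · refine (Equiv.subtypeSubtypeEquivSubtypeInter (fun y => ¬ t y = b)
        fun y => t y = (e₁ d).1).symm.trans (Equiv.subtypeEquivRight fun y => ?_)
      simp only [ψ, Subtype.ext_iff]
  let e₂ : {x // ¬ s x = a} ≃ {y // ¬ t y = b} := Equiv.ofFiberEquiv fun c => (hφ c).some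
  have he₂ : ∀ x, ψ (e₂ x) = φ x := Equiv.ofFiberEquiv_map _
  let e : M ≃ N :=
    (Equiv.sumCompl (fun x => s x = a)).symm.trans
      ((Equiv.sumCongr e₁ e₂).trans (Equiv.sumCompl (fun y => t y = b)))
  have e_pos : ∀ x (hx : s x = a), e x = (e₁ ⟨x, hx⟩).1 := by
    intro x hx
    change Equiv.sumCompl (fun y => t y = b)
      (Sum.map e₁ e₂ ((Equiv.sumCompl fun x => s x = a).symm x)) = _
    rw [Equiv.sumCompl_symm_apply_of_pos (p := fun x => s x = a) hx]
    rfl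
  have e_neg : ∀ x (hx : ¬ s x = a), e x = (e₂ ⟨x, hx⟩).1 := by
    intro x hx
    change Equiv.sumCompl (fun y => t y = b)
      (Sum.map e₁ e₂ ((Equiv.sumCompl fun x => s x = a).symm x)) = _
    rw [Equiv.sumCompl_symm_apply_of_neg (p := fun x => s x = a) hx]
    rfl
  refine ⟨e, fun x => ?_⟩
  rw [e_pos (s x) (hs x)]
  by_cases hx : s x = a
  · have : (⟨s x, hs x⟩ : {x // s x = a}) = ⟨a, apply_root hs⟩ := Subtype.ext hx
    rw [this, hroot, e_pos x hx, (e₁ ⟨x, hx⟩).2]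
  · rw [e_neg x hx]
    exact (congrArg Subtype.val (he₂ ⟨x, hx⟩)).symm

end Classification

/-! ### The fibre invariant -/

/-- The cardinalities of the fibres of a map. -/
def fibreCards {M : Type u} (s : M → M) : Set Cardinal.{u} :=
  range fun x => #{y // s y = x}

theorem fibreCards_congr {M N : Type u} {s : M → M} {t : N → N} (e : M ≃ N)
    (he : ∀ x, e (s x) = t (e x)) : fibreCards s = fibreCards t := by
  refine Eq.trans (congrArg range (funext fun x => ?_))
    (e.surjective.range_comp fun x => #{y // t y = x})
  refine Cardinal.mk_congr (e.subtypeEquiv fun y => ?_)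
  rw [← he, e.apply_eq_iff_eq]

/-! ### Representation by homomorphisms -/

/-- If the homomorphisms into `({0, 1, 2}, predOp)` that map `t` to `2` separate the points of
`(M, s)`, then `(M, s)` is isomorphic to a subdirect power, with these homomorphisms as
coordinates. -/
theorem exists_subdirectPower_of_separating {M : Type u} (s : M → M) (t : M)
    (hsep : ∀ x y, x ≠ y → ∃ φ : M → Fin 3,
      (∀ z, φ (s z) = predOp (φ z)) ∧ φ t = 2 ∧ φ x ≠ φ y) :
    ∃ S : SubdirectPower.{u} predOp, ∃ e : M ≃ S.carrier, ∀ x, e (s x) = S.op (e x) := by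
  let I : Type u := {φ : M → Fin 3 // (∀ z, φ (s z) = predOp (φ z)) ∧ φ t = 2}
  let ev : M → I → Fin 3 := fun x φ => φ.1 x
  have hev : Injective ev := by
    intro x y hxy
    by_contra hne
    obtain ⟨φ, h1, h2, h3⟩ := hsep x y hne
    exact h3 (congrFun hxy ⟨φ, h1, h2⟩)
  have hop : ∀ x, ev (s x) = fun i => predOp (ev x i) := fun x => funext fun φ => φ.2.1 x
  refine ⟨⟨I, range ev, ?_, ?_⟩, Equiv.ofInjective ev hev, fun x => Subtype.ext (hop x)⟩
  · rintro _ ⟨x, rfl⟩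
    exact ⟨s x, hop x⟩
  · intro φ c
    have h2 : ev t φ = 2 := φ.2.2
    have h1 : ev (s t) φ = 1 := (congrFun (hop t) φ).trans (congrArg predOp h2)
    have h0 : ev (s (s t)) φ = 0 := (congrFun (hop (s t)) φ).trans (congrArg predOp h1)
    fin_cases c
    · exact ⟨_, ⟨_, rfl⟩, h0⟩
    · exact ⟨_, ⟨_, rfl⟩, h1⟩
    · exact ⟨_, ⟨_, rfl⟩, h2⟩

/-- The vertices of a tree of height two: a root, a branch `stem — tip` attached to it, and further
vertices `node l` of depth one, where `node l` has the set `K l` of children. -/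
inductive Tree {L : Type u} (K : L → Type u) : Type u
  | root : Tree K
  | stem : Tree K
  | tip : Tree K
  | node (l : L) : Tree K
  | leaf (l : L) (k : K l) : Tree K

namespace Tree

variable {L : Type u} {K : L → Type u}

/-- The parent map of a tree, fixing the root. -/
def parent : Tree K → Tree K
  | root => root
  | stem => root
  | tip => stem
  | node _ => root
  | leaf l _ => node l

/-- The homomorphism that is `0, 1, 2` along the branch `root — stem — tip`, and elsewhere is `1`
on the leaves in `Z` and `0` otherwise. -/
noncomputable def leafHom (Z : Set (Σ l, K l)) : Tree K → Fin 3
  | root => 0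
  | stem => 1
  | tip => 2
  | node _ => 0
  | leaf l k => by classical exact if (⟨l, k⟩ : Σ l, K l) ∈ Z then 1 else 0

/-- The homomorphism that is `0, 1, 2` along the branch `root — stem — tip`, takes the value `1` on
the nodes in `Z` and `2` on their children, and is `0` otherwise. -/
noncomputable def nodeHom (Z : Set L) : Tree K → Fin 3
  | root => 0
  | stem => 1
  | tip => 2
  | node l => by classical exact if l ∈ Z then 1 else 0
  | leaf l _ => by classical exact if l ∈ Z then 2 else 0

theorem leafHom_parent (Z : Set (Σ l, K l)) (x : Tree K) :
    leafHom Z (parent x) = predOp (leafHom Z x) := by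
  cases x <;> simp only [parent, leafHom] <;> first | rfl | (split_ifs <;> rfl)

theorem nodeHom_parent (Z : Set L) (x : Tree K) :
    nodeHom Z (parent x) = predOp (nodeHom Z x) := by
  cases x <;> simp only [parent, nodeHom] <;> first | rfl | (split_ifs <;> rfl)

/-- A vertex is determined by its images under the homomorphisms `leafHom Z` and `nodeHom Z`. The
cases `Z = ∅` and `Z = univ` distinguish the kinds of vertices, and singletons distinguish vertices
of the same kind. -/
theorem ext_of_homs {x y : Tree K} (h1 : ∀ Z, leafHom Z x = leafHom Z y)
    (h2 : ∀ Z, nodeHom Z x = nodeHom Z y) : x = y := by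
  have h1₀ := h1 ∅
  have h1₁ := h1 univ
  have h2₁ := h2 univ
  rcases x with _ | _ | _ | l | ⟨l, k⟩ <;> rcases y with _ | _ | _ | l' | ⟨l', k'⟩ <;>
    simp only [leafHom, nodeHom, mem_empty_iff_false, mem_univ, if_true, if_false,
      Fin.reduceEq, zero_ne_one, one_ne_zero] at h1₀ h1₁ h2₁ ⊢
  · simpa [nodeHom, eq_comm] using h2 {l}
  · have h := h1 {⟨l, k⟩}
    simp only [leafHom, mem_singleton_iff, if_true] at h
    split_ifs at h with h'
    · simpa using h'.symm
    · simp at h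

theorem exists_subdirectPower (K : L → Type u) :
    ∃ S : SubdirectPower.{u} predOp, ∃ e : Tree K ≃ S.carrier,
      ∀ x, e (parent x) = S.op (e x) := by
  refine exists_subdirectPower_of_separating parent tip fun x y hxy => ?_
  by_contra! hc
  exact hxy (ext_of_homs (fun Z => hc _ (leafHom_parent Z) rfl)
    fun Z => hc _ (nodeHom_parent Z) rfl)

theorem mk_le {κ : Cardinal.{u}} (hκ : ℵ₀ ≤ κ) (hL : #L ≤ κ) (hK : ∀ l, #(K l) ≤ κ) :
    #(Tree K) ≤ κ := by
  let f : Fin 3 ⊕ L ⊕ (Σ l, K l) → Tree K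
    | .inl 0 => root
    | .inl 1 => stem
    | .inl 2 => tip
    | .inr (.inl l) => node l
    | .inr (.inr ⟨l, k⟩) => leaf l k
  have hf : Surjective f := by
    rintro (_ | _ | _ | l | ⟨l, k⟩)
    · exact ⟨.inl 0, rfl⟩
    · exact ⟨.inl 1, rfl⟩
    · exact ⟨.inl 2, rfl⟩
    · exact ⟨.inr (.inl l), rfl⟩
    · exact ⟨.inr (.inr ⟨l, k⟩), rfl⟩
  have hsum : #(Σ l, K l) ≤ κ := by
    rw [mk_sigma]
    calc Cardinal.sum (fun l => #(K l))
      _ ≤ Cardinal.sum (fun _ : L => κ) := Cardinal.sum_le_sum _ _ hK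
      _ = #L * κ := by simp
      _ ≤ κ := (mul_le_mul' hL le_rfl).trans (mul_eq_self hκ).le
  calc #(Tree K) ≤ #(Fin 3 ⊕ L ⊕ (Σ l, K l)) := mk_le_of_surjective hf
    _ ≤ κ := by
      simp only [mk_sum, Cardinal.lift_id, mk_fin, Cardinal.lift_natCast]
      refine add_le_of_le hκ ((natCast_le_aleph0 (n := 3)).trans hκ) ?_
      simpa using add_le_of_le hκ hL hsum

/-- The fibre of `stem` is `{tip}`, the fibre of `node l` is a copy of `K l`, the fibres of `tip`
and of the leaves are empty, and the fibre of the root contains all nodes, hence has as many elements as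
the whole tree. -/
theorem fibreCards_parent {κ : Cardinal.{u}} (hT : #(Tree K) = κ) (hL : #L = κ) :
    fibreCards (parent (K := K)) = {0, 1, κ} ∪ range fun l => #(K l) := by
  have h_root : #{y : Tree K // parent y = root} = κ := by
    refine le_antisymm ((mk_subtype_le _).trans hT.le) (hL ▸ ?_)
    exact mk_le_of_injective (f := fun l => ⟨node l, rfl⟩) fun l l' h => by
      simpa using congrArg Subtype.val h
  have h_stem : #{y : Tree K // parent y = stem} = 1 := by
    rw [Cardinal.eq_one_iff_unique]
    refine ⟨⟨?_⟩, ⟨⟨tip, rfl⟩⟩⟩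
    rintro ⟨x, hx⟩ ⟨y, hy⟩
    cases x <;> cases hx
    cases y <;> cases hy
    rfl
  have h_tip : #{y : Tree K // parent y = tip} = 0 := by
    rw [Cardinal.mk_eq_zero_iff, isEmpty_subtype]
    rintro (_ | _ | _ | _ | _) h <;> cases h
  have h_leaf (l : L) (k : K l) : #{y : Tree K // parent y = leaf l k} = 0 := by
    rw [Cardinal.mk_eq_zero_iff, isEmpty_subtype]
    rintro (_ | _ | _ | _ | _) h <;> cases h
  have h_node (l : L) : #{y : Tree K // parent y = node l} = #(K l) := by
    refine (Cardinal.mk_congr (Equiv.ofBijective (fun k => ⟨leaf l k, rfl⟩) ⟨?_, ?_⟩)).symm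
    · intro k k' h
      simpa using congrArg Subtype.val h
    · rintro ⟨y, hy⟩
      cases y <;> cases hy
      exact ⟨_, rfl⟩
  ext β
  constructor
  · rintro ⟨_ | _ | _ | l | ⟨l, k⟩, rfl⟩
    · simp [h_root]
    · simp [h_stem]
    · simp [h_tip]
    · simp only [h_node]; exact Or.inr ⟨l, rfl⟩
    · simp [h_leaf]
  · rintro ((rfl | rfl | rfl) | ⟨l, rfl⟩)
    · exact ⟨_, h_tip⟩
    · exact ⟨_, h_stem⟩
    · exact ⟨_, h_root⟩
    · exact ⟨_, h_node l⟩

end Tree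

/-! ### Sets of cardinals -/

/-- The cardinals up to `κ`, except `0`, `1` and `κ`, which occur as cardinalities of fibres in all
the trees used for the lower bound. -/
abbrev freeCards (κ : Cardinal.{u}) : Set Cardinal.{u} := Iic κ \ {0, 1, κ}

theorem aleph0_le_mk_Iic {κ : Cardinal.{u}} (hκ : ℵ₀ ≤ κ) : ℵ₀ ≤ #(Iic κ) := by
  rw [Cardinal.aleph0_le_mk_iff]
  exact Infinite.of_injective (fun n : ℕ => ⟨(n : Cardinal.{u}), natCast_le_aleph0.trans hκ⟩)
    fun m n h => by simpa using congrArg Subtype.val h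

theorem mk_freeCards {κ : Cardinal.{u}} (hκ : ℵ₀ ≤ κ) : #(freeCards κ) = #(Iic κ) := by
  refine le_antisymm (mk_le_mk_of_subset sdiff_subset) (le_of_not_gt fun hlt => ?_)
  have hfin : #({0, 1, κ} : Set Cardinal.{u}) < ℵ₀ :=
    Cardinal.lt_aleph0_iff_finite.2 (Set.toFinite _)
  exact (le_mk_sdiff_add_mk (Iic κ) {0, 1, κ}).not_gt
    (add_lt_of_lt (aleph0_le_mk_Iic hκ) hlt (hfin.trans_le (aleph0_le_mk_Iic hκ)))

/-- There are at most `κ` cardinals below `κ`. -/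
theorem mk_freeCards_le (κ : Cardinal.{u}) : #(freeCards κ) ≤ Cardinal.lift.{u + 1} κ := by
  have h := mk_le_of_injective (α := freeCards κ) (β := Iio κ.ord)
    (f := fun β => ⟨β.1.ord, ord_lt_ord.2 (lt_of_le_of_ne β.2.1 fun h => β.2.2 (by simp [h]))⟩)
    fun β γ h => Subtype.ext (ord_injective (congrArg Subtype.val h))
  simpa [Cardinal.mk_Iio_ordinal] using h

instance small_freeCards (κ : Cardinal.{u}) : Small.{u} (freeCards κ) :=
  small_subset sdiff_subset

/-- Every set `T` of cardinals below `κ` different from `0` and `1` is realized by a subdirect power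
of cardinality `κ`, as the set of cardinalities of fibres different from `0`, `1` and `κ`. -/
theorem exists_subdirectPower_fibreCards {κ : Cardinal.{u}} (hκ : ℵ₀ ≤ κ) (T : Set (freeCards κ)) :
    ∃ S : SubdirectPower.{u} predOp, #S.carrier = κ ∧
      fibreCards S.op = {0, 1, κ} ∪ Subtype.val '' T := by
  let L : Type u := Shrink.{u} T ⊕ κ.out
  -- The summand `κ.out` consists of `κ` childless nodes.
  let K : L → Type u := Sum.elim (fun i => ((equivShrink T).symm i).1.1.out) fun _ => PEmpty
  have hT : #(Shrink.{u} T) ≤ κ := by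
    rw [← Cardinal.lift_le.{u + 1}, Cardinal.lift_mk_shrink'']
    exact (mk_subtype_le _).trans (mk_freeCards_le κ)
  have hL : #L = κ := by
    simp only [L, mk_sum, Cardinal.lift_id, mk_out]
    exact add_eq_right hκ hT
  have hK : ∀ l, #(K l) ≤ κ := by
    rintro (i | i)
    · simpa [K] using ((equivShrink T).symm i).1.2.1
    · simp [K]
  have hTree : #(Tree K) = κ :=
    le_antisymm (Tree.mk_le hκ hL.le hK)
      (hL ▸ mk_le_of_injective (f := Tree.node) fun l l' h => by simpa using h)
  obtain ⟨S, e, he⟩ := Tree.exists_subdirectPower K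
  refine ⟨S, (Cardinal.mk_congr e).symm.trans hTree, ?_⟩
  rw [← fibreCards_congr e he, Tree.fibreCards_parent hTree hL]
  ext β
  constructor
  · rintro (h | ⟨i | i, rfl⟩)
    · exact Or.inl h
    · refine Or.inr ⟨_, ((equivShrink T).symm i).2, ?_⟩
      simp [K]
    · simp [K]
  · rintro (h | ⟨γ, hγ, rfl⟩)
    · exact Or.inl h
    · refine Or.inr ⟨.inl (equivShrink T ⟨γ, hγ⟩), ?_⟩
      simp [K]

/-! ### Counting subdirect powers -/

theorem two_power_le_numSubdirectPowers {κ : Cardinal.{u}} (hκ : ℵ₀ ≤ κ) :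
    2 ^ #(Iic κ) ≤ numSubdirectPowers predOp κ := by
  choose S hS hST using exists_subdirectPower_fibreCards hκ
  rw [← mk_freeCards hκ, ← mk_set]
  refine mk_le_of_injective
    (f := fun T => Quotient.mk (SubdirectPower.isoSetoid predOp κ) ⟨S T, hS T⟩) fun T T' h => ?_
  obtain ⟨e, he⟩ := Quotient.exact h
  have hTT' := fibreCards_congr e he
  rw [hST, hST] at hTT'
  refine Subtype.val_injective.image_injective ?_
  have key : ∀ T : Set (freeCards κ),
      ({0, 1, κ} ∪ Subtype.val '' T) \ {0, 1, κ} = Subtype.val '' T := fun T => by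
    rw [union_sdiff_left, sdiff_eq_left, disjoint_left]
    rintro _ ⟨β, -, rfl⟩
    exact β.2.2
  rw [← key T, ← key T', hTT']

theorem predOp_predOp (c : Fin 3) : predOp (predOp c) = 0 := by
  revert c; decide

/-- A nonempty subdirect power is a tree of height at most two. -/
theorem exists_root (S : SubdirectPower.{u} predOp) [Nonempty S.carrier] :
    ∃ a, ∀ x, S.op (S.op x) = a := by
  obtain ⟨x₀⟩ := ‹Nonempty S.carrier›
  exact ⟨S.op (S.op x₀), fun x => Subtype.ext (funext fun i =>
    (predOp_predOp (x.1 i)).trans (predOp_predOp (x₀.1 i)).symm)⟩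

theorem numSubdirectPowers_le {κ : Cardinal.{u}} (hκ : ℵ₀ ≤ κ) :
    numSubdirectPowers predOp κ ≤ 2 ^ #(Iic κ) := by
  have hne (q : Quotient (SubdirectPower.isoSetoid predOp κ)) : Nonempty q.out.1.carrier := by
    rw [← mk_ne_zero_iff, q.out.2]
    exact (aleph0_pos.trans_le hκ).ne'
  choose a ha using fun q : Quotient (SubdirectPower.isoSetoid predOp κ) =>
    @exists_root q.out.1 (hne q)
  -- Profiles and their arguments beyond `κ` carry no information.
  let F (q : Quotient (SubdirectPower.isoSetoid predOp κ)) (c : Prop × Iic κ) : Iic κ :=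
    ⟨profile q.out.1.op (a q) c.1 c.2.1,
      ((mk_subtype_le _).trans (mk_subtype_le _)).trans q.out.2.le⟩
  have hF : Injective F := by
    intro q r h
    have hprof : ∀ p β, profile q.out.1.op (a q) p β = profile r.out.1.op (a r) p β := by
      intro p β
      by_cases hβ : β ≤ κ
      · exact congrArg Subtype.val (congrFun h (p, ⟨β, hβ⟩))
      · have hzero (q : Quotient (SubdirectPower.isoSetoid predOp κ)) :
            profile q.out.1.op (a q) p β = 0 := by
          rw [profile, Cardinal.mk_eq_zero_iff, isEmpty_subtype]
          rintro x ⟨-, rfl⟩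
          exact hβ ((mk_subtype_le _).trans q.out.2.le)
        rw [hzero, hzero]
    rw [← q.out_eq, ← r.out_eq]
    exact Quotient.sound (exists_equiv_of_profile_eq (ha q) (ha r) hprof)
  have hα := aleph0_le_mk_Iic hκ
  have hdom : #(Prop × Iic κ) = #(Iic κ) := by
    rw [mk_prod, mk_Prop]
    simpa using Cardinal.mul_eq_right hα ((natCast_le_aleph0 (n := 2)).trans hα) two_ne_zero
  calc numSubdirectPowers predOp κ ≤ #(Prop × Iic κ → Iic κ) := mk_le_of_injective hF
    _ = 2 ^ #(Iic κ) := by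
      rw [← Cardinal.power_def, hdom, power_self_eq hα]

theorem mk_Iic_aleph_one : #(Iic (aleph 1 : Cardinal.{u})) = ℵ₀ := by
  refine le_antisymm ?_ (aleph0_le_mk_Iic aleph0_lt_aleph_one.le)
  rw [Cardinal.le_aleph0_iff_set_countable]
  refine ((countable_range (Nat.cast : ℕ → Cardinal.{u})).union
    (Set.toFinite {ℵ₀, aleph 1}).countable).mono fun β hβ => ?_
  rcases lt_or_ge β ℵ₀ with h | h
  · obtain ⟨n, rfl⟩ := lt_aleph0.1 h
    exact Or.inl ⟨n, rfl⟩
  · rcases h.eq_or_lt with h | h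
    · simp [h]
    · have : aleph 1 ≤ β := by rwa [← succ_aleph0, Order.succ_le_iff]
      simp [le_antisymm hβ this]

end UnaryTree

theorem mainTheorem4 :
    (∀ κ : Cardinal.{u}, ℵ₀ ≤ κ →
      numSubdirectPowers predOp κ = 2 ^ #{β : Cardinal.{u} // β ≤ κ}) ∧
    ((2 : Cardinal.{0}) ^ (ℵ₀ : Cardinal.{0}) = Cardinal.aleph 1 →
      numSubdirectPowers predOp (Cardinal.aleph 1 : Cardinal.{u}) = 2 ^ (ℵ₀ : Cardinal.{u + 1}) ∧
      numSubdirectPowers predOp (Cardinal.aleph 1 : Cardinal.{u}) <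
        2 ^ (Cardinal.aleph 1 : Cardinal.{u + 1})) := by
  have main : ∀ κ : Cardinal.{u}, ℵ₀ ≤ κ → numSubdirectPowers predOp κ = 2 ^ #(Set.Iic κ) :=
    fun κ hκ => le_antisymm (UnaryTree.numSubdirectPowers_le hκ)
      (UnaryTree.two_power_le_numSubdirectPowers hκ)
  refine ⟨main, fun hCH => ?_⟩
  have h1 : numSubdirectPowers predOp (Cardinal.aleph 1 : Cardinal.{u})
      = 2 ^ (ℵ₀ : Cardinal.{u + 1}) := by
    rw [main _ Cardinal.aleph0_lt_aleph_one.le, UnaryTree.mk_Iic_aleph_one]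
  refine ⟨h1, h1 ▸ ?_⟩
  -- The continuum hypothesis is assumed in the lowest universe and has to be lifted.
  have hCH' : (2 : Cardinal.{u + 1}) ^ (ℵ₀ : Cardinal.{u + 1}) = Cardinal.aleph 1 := by
    simpa using congrArg Cardinal.lift.{u + 1} hCH
  rw [hCH']
  exact Cardinal.cantor _
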